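/- Let $H$ be a separable infinite-dimensional complex Hilbert space. A sequence $(s_k)_{k\ge1}$ of real numbers is called an eigenvalue sequence of a positive compact operator $T$ on $H$ if every nonzero number occurs in it exactly as many times as the dimension of the corresponding eigenspace of $T$ (the order being irrelevant), and $0$ occurs in it at most $\dim\ker T$ times. An operator is strictly positive if $\langle Tx,x\rangle>0$ for all $x\neq0$. (1) Let $0\le d_1\le d_2\le\cdots$ with $d_n/n\to0$. Then every positive compact operator $T$ on $H$ with eigenvalue sequence $$\Bigl(d_1,\tfrac{d_2-d_1}{2},\tfrac{d_2-d_1}{2},\tfrac{d_3-d_2}{3},\tfrac{d_3-d_2}{3},\tfrac{d_3-d_2}{3},\dots\Bigr)$$ (where $(d_n-d_{n-1})/n$ is repeated $n$ times) is a single commutator $T=CZ-ZC$ of compact operators $C,Z$ on $H$. (2) Let $d_n\ge0$ for $n\ge1$ with $\frac1n\sum_{j=1}^n d_j\to0$. Then every positive compact operator $T$ on $H$ with eigenvalue sequence $$\Bigl(d_1,\tfrac{d_2}{2},\tfrac{d_2}{2},\tfrac{d_3}{3},\tfrac{d_3}{3},\tfrac{d_3}{3},\dots\Bigr)$$ (where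 $d_n/n$ is repeated $n$ times) is a single commutator of compact operators on $H$. (3) The two conditions are equivalent: a sequence has the form displayed in (1) for some $(d_n)$ as in (1) if and only if it has the form displayed in (2) for some $(d_n)$ as in (2). (4) The sequences $d_n=\sqrt n$ and $d_n=\log(n+1)$ satisfy the hypotheses of (1), and for each of them there is a strictly positive compact operator on $H$ with the eigenvalue sequence of (1), which is thus a single commutator of compact operators. The sequence $d_n=\log n$ satisfies the hypotheses of (1) as well; there is a positive compact operator on $H$ with the corresponding eigenvalue sequence and a one-dimensional kernel (because $d_1=0$), and it is a single commutator of compact operators. -/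

import Mathlib

/-!
On `ℓ²(ℕ × ℕ)` take two harmonic oscillators with annihilation operators `A₁`, `A₂` and creation
operators `B₁`, `B₂`, weighted so that `A₁ A₂ = A₂ A₁`, `B₁ B₂ = B₂ B₁` and all four operators are
compact. For `C = A₁ + B₂` and `Z = B₁ - A₂` the mixed terms of `C Z - Z C` cancel and
`[A₁, B₁] + [A₂, B₂]` remains, a diagonal operator whose entries depend only on the total degree.
The vectors of degree `n - 1` span a space of dimension `n`, and if the weight `β N` joining the
degrees `N` and `N + 1` satisfies `β N ^ 2 = d (N + 1) / (N + 2)`, then the diagonal entry in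
degree `n - 1` telescopes to `(d n - d (n - 1)) / n`. A compact self-adjoint operator with these
eigenvalues is unitarily equivalent to this diagonal operator, extended by zero.
-/

/-- A bounded operator is a (single) commutator of compact operators if it equals `C Z - Z C`
for some compact operators `C` and `Z` on the same space. -/
def IsCommutatorOfCompacts {H : Type*} [NormedAddCommGroup H] [InnerProductSpace ℂ H]
    (T : H →L[ℂ] H) : Prop :=
  ∃ C Z : H →L[ℂ] H, IsCompactOperator C ∧ IsCompactOperator Z ∧ T = C ∘L Z - Z ∘L C

/-- Strict positivity: `⟪T x, x⟫` is real and positive for all nonzero `x`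
(a positive operator with trivial kernel; it need not be invertible). -/
def IsStrictlyPositiveOperator {H : Type*} [NormedAddCommGroup H] [InnerProductSpace ℂ H]
    (T : H →L[ℂ] H) : Prop :=
  T.IsPositive ∧ ∀ x : H, x ≠ 0 → 0 < RCLike.re (inner ℂ (T x) x)

/-- `s` lists the eigenvalues of `T` with multiplicity, in no particular order: each nonzero
complex number occurs in `s` exactly as many times as the dimension of its eigenspace (so not at
all if it is not an eigenvalue), and `0` occurs at most `dim ker T` times. So the kernel may be
listed in full, in part, or not at all, which covers all the usual conventions on zeros. -/
def HasEigenvalueSequence {H : Type*} [NormedAddCommGroup H] [InnerProductSpace ℂ H]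
    (T : H →L[ℂ] H) (s : ℕ → ℝ) : Prop :=
  (∀ μ : ℂ, μ ≠ 0 → {k : ℕ | (s k : ℂ) = μ}.encard =
    Cardinal.toENat (Module.rank ℂ (Module.End.eigenspace (T : H →ₗ[ℂ] H) μ))) ∧
  {k : ℕ | s k = 0}.encard ≤
    Cardinal.toENat (Module.rank ℂ (LinearMap.ker (T : H →ₗ[ℂ] H)))

theorem exists_lt_triangle (k : ℕ) : ∃ n : ℕ, k < n * (n + 1) / 2 := by
  refine ⟨k + 1, ?_⟩
  have h : k + 1 ≤ (k + 1) * (k + 1 + 1) / 2 := by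
    rw [Nat.le_div_iff_mul_le (by norm_num)]
    nlinarith
  omega

/-- Cut `0, 1, 2, 3, …` into consecutive blocks of lengths `1, 2, 3, …`; this is the number
(and length) of the block that contains `k`: it takes the values `1, 2, 2, 3, 3, 3, 4, …`. -/
def blockNumber (k : ℕ) : ℕ := Nat.find (exists_lt_triangle k)

/-- The sequence `(a 1, a 2, a 2, a 3, a 3, a 3, …)`, in which `a n` is repeated `n` times. -/
def repeatBlocks (a : ℕ → ℝ) : ℕ → ℝ := fun k => a (blockNumber k)

/-- The sequence `(d 1, (d 2 - d 1)/2, (d 2 - d 1)/2, (d 3 - d 2)/3, …)`. Sequences `d` are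
indexed from `1`; the value `d 0` is never used. -/
noncomputable def incrementEigenvalues (d : ℕ → ℝ) : ℕ → ℝ :=
  repeatBlocks fun n => if n = 1 then d 1 else (d n - d (n - 1)) / n

/-- The sequence `(d 1, (d 2)/2, (d 2)/2, (d 3)/3, (d 3)/3, (d 3)/3, …)`. -/
noncomputable def directEigenvalues (d : ℕ → ℝ) : ℕ → ℝ :=
  repeatBlocks fun n => d n / n

/-- `0 ≤ d 1 ≤ d 2 ≤ …` and `d n / n → 0`. -/
def IncrementCondition (d : ℕ → ℝ) : Prop :=
  (∀ n, 1 ≤ n → 0 ≤ d n) ∧ (∀ n, 1 ≤ n → d n ≤ d (n + 1)) ∧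
    Filter.Tendsto (fun n : ℕ => d n / n) Filter.atTop (nhds 0)

/-- `d n ≥ 0` for `n ≥ 1`, and the arithmetic means `(d 1 + … + d n)/n` tend to `0`. -/
def MeanCondition (d : ℕ → ℝ) : Prop :=
  (∀ n, 1 ≤ n → 0 ≤ d n) ∧
    Filter.Tendsto (fun n : ℕ => (1 / (n : ℝ)) * ∑ j ∈ Finset.Icc 1 n, d j)
      Filter.atTop (nhds 0)

open Filter Topology
open scoped lp

section Diagonal

variable {ι : Type*} {w : ι → ℂ}

/-- The diagonal operator `e i ↦ w i • e i` on `ℓ²`, for weights `w` that tend to zero. -/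
noncomputable def diagonalOperator (hw : Tendsto w cofinite (𝓝 0)) :
    ℓ²(ι, ℂ) →L[ℂ] ℓ²(ι, ℂ) :=
  lp.mapCLM 2 (fun i => w i • ContinuousLinearMap.id ℂ ℂ) (K := ⨆ i, ‖w i‖)
    (Real.iSup_nonneg fun _ => norm_nonneg _) fun i => by
      simpa [norm_smul] using le_ciSup hw.norm.bddAbove_range_of_cofinite i

@[simp]
theorem diagonalOperator_apply (hw : Tendsto w cofinite (𝓝 0)) (x : ℓ²(ι, ℂ)) (i : ι) :
    diagonalOperator hw x i = w i * x i :=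
  rfl

theorem diagonalOperator_single [DecidableEq ι] (hw : Tendsto w cofinite (𝓝 0)) (i : ι) (c : ℂ) :
    diagonalOperator hw (lp.single 2 i c) = w i • lp.single 2 i c := by
  ext j
  obtain rfl | hij := eq_or_ne j i <;> simp_all

theorem norm_diagonalOperator_sub_le {v : ι → ℂ} (hw : Tendsto w cofinite (𝓝 0))
    (hv : Tendsto v cofinite (𝓝 0)) {K : ℝ} (hK : 0 ≤ K) (h : ∀ i, ‖w i - v i‖ ≤ K) :
    ‖diagonalOperator hw - diagonalOperator hv‖ ≤ K := by
  have hwv : Tendsto (fun i => w i - v i) cofinite (𝓝 0) := by simpa using hw.sub hv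
  have hsub : diagonalOperator hw - diagonalOperator hv = diagonalOperator hwv := by
    ext x i
    exact (sub_mul (w i) (v i) (x i)).symm
  rw [hsub]
  exact (lp.norm_mapCLM_le 2 _ _ _).trans (Real.iSup_le (by simpa [norm_smul] using h) hK)

theorem isCompactOperator_diagonalOperator_of_finset (hw : Tendsto w cofinite (𝓝 0))
    {s : Finset ι} (hs : ∀ i ∉ s, w i = 0) : IsCompactOperator (diagonalOperator hw) := by
  classical
  let R (i : ι) : ℓ²(ι, ℂ) →L[ℂ] ℓ²(ι, ℂ) :=
    lp.singleContinuousLinearMap ℂ (fun _ : ι => ℂ) 2 i ∘L (w i • lp.evalCLM ℂ _ 2 i)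
  have hR (i : ι) : IsCompactOperator (R i) :=
    IsCompactOperator.comp_clm (isCompactOperator_of_locallyCompactSpace_rng
      (lp.singleContinuousLinearMap ℂ (fun _ : ι => ℂ) 2 i)) _
  have hR_apply (i : ι) (x : ℓ²(ι, ℂ)) (j : ι) : R i x j = if j = i then w i * x i else 0 := by
    simp only [R, ContinuousLinearMap.comp_apply, lp.singleContinuousLinearMap_apply,
      lp.single_apply, Pi.single_apply]
    rfl
  have hsum : diagonalOperator hw = ∑ i ∈ s, R i := by
    ext x j
    rw [sum_apply, lp.coeFn_sum, Finset.sum_apply]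
    simp +contextual [hR_apply, hs]
  rw [hsum]
  exact (compactOperator (RingHom.id ℂ) ℓ²(ι, ℂ) ℓ²(ι, ℂ)).sum_mem fun i _ => hR i

theorem isCompactOperator_diagonalOperator (hw : Tendsto w cofinite (𝓝 0)) :
    IsCompactOperator (diagonalOperator hw) := by
  classical
  have htrunc (s : Finset ι) : Tendsto (fun i => if i ∈ s then w i else 0) cofinite (𝓝 0) := by
    refine tendsto_const_nhds.congr' ?_
    filter_upwards [s.finite_toSet.compl_mem_cofinite] with i hi
    exact (if_neg hi).symm
  refine isCompactOperator_of_tendsto (l := atTop) (F := fun s => diagonalOperator (htrunc s)) ?_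
    (Eventually.of_forall fun s =>
      isCompactOperator_diagonalOperator_of_finset (s := s) _ fun i hi => if_neg hi)
  refine Metric.tendsto_atTop.mpr fun ε hε => ?_
  have hfin : {i | ¬ ‖w i‖ < ε / 2}.Finite :=
    hw.norm.eventually (gt_mem_nhds (by simpa using hε))
  refine ⟨hfin.toFinset, fun s hs => ?_⟩
  rw [dist_comm, dist_eq_norm]
  refine (norm_diagonalOperator_sub_le _ _ (half_pos hε).le fun i => ?_).trans_lt
    (half_lt_self hε)
  split_ifs with hi
  · simpa using (half_pos hε).le
  · contrapose! hi
    exact hs (by simpa using hi.le)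

end Diagonal

section Synthesis

variable {ι H : Type*} [NormedAddCommGroup H] [InnerProductSpace ℂ H] [CompleteSpace H]
  {e : ι → H}

/-- The synthesis operator `∑ i, c i • e i` of an orthonormal family. -/
noncomputable def synthesis (he : Orthonormal ℂ e) : ℓ²(ι, ℂ) →L[ℂ] H :=
  he.orthogonalFamily.linearIsometry.toContinuousLinearMap

theorem synthesis_single [DecidableEq ι] (he : Orthonormal ℂ e) (i : ι) (c : ℂ) :
    synthesis he (lp.single 2 i c) = c • e i := by
  simp [synthesis, OrthogonalFamily.linearIsometry_apply_single]

theorem adjoint_synthesis_comp_synthesis (he : Orthonormal ℂ e) :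
    (synthesis he).adjoint ∘L synthesis he = ContinuousLinearMap.id ℂ _ :=
  (ContinuousLinearMap.norm_map_iff_adjoint_comp_self _).mp
    he.orthogonalFamily.linearIsometry.norm_map

theorem adjoint_synthesis_apply (he : Orthonormal ℂ e) (y : H) (i : ι) :
    (synthesis he).adjoint y i = inner ℂ (e i) y := by
  classical
  have := lp.inner_single_left (𝕜 := ℂ) i (1 : ℂ) ((synthesis he).adjoint y)
  rw [ContinuousLinearMap.adjoint_inner_right, synthesis_single, one_smul] at this
  simpa using this.symm

end Synthesis

section Shift

variable {ι : Type*} {σ : ι → ι}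

theorem orthonormal_single_comp [DecidableEq ι] (hσ : σ.Injective) :
    Orthonormal ℂ fun i => (lp.single 2 (σ i) 1 : ℓ²(ι, ℂ)) := by
  refine orthonormal_iff_ite.mpr fun i j => ?_
  simp [lp.inner_single_left, Pi.single_apply, hσ.eq_iff]

open Classical in
/-- The isometry of `ℓ²` that sends the `i`-th unit vector to the `σ i`-th one. -/
noncomputable def shift (hσ : σ.Injective) : ℓ²(ι, ℂ) →L[ℂ] ℓ²(ι, ℂ) :=
  synthesis (orthonormal_single_comp hσ)

@[simp]
theorem adjoint_shift_apply (hσ : σ.Injective) (x : ℓ²(ι, ℂ)) (i : ι) :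
    (shift hσ).adjoint x i = x (σ i) := by
  simp [shift, adjoint_synthesis_apply, lp.inner_single_left]

@[simp]
theorem shift_apply_self (hσ : σ.Injective) (x : ℓ²(ι, ℂ)) (i : ι) : shift hσ x (σ i) = x i := by
  rw [← adjoint_shift_apply hσ, ← ContinuousLinearMap.comp_apply, shift,
    adjoint_synthesis_comp_synthesis, ContinuousLinearMap.id_apply]

theorem shift_apply_of_notMem_range (hσ : σ.Injective) (x : ℓ²(ι, ℂ)) {i : ι}
    (hi : i ∉ Set.range σ) : shift hσ x i = 0 := by
  classical
  have hsingle : (shift hσ).adjoint (lp.single 2 i 1) = 0 := by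
    ext j
    simpa [Pi.single_apply] using fun h => hi ⟨j, h⟩
  have := lp.inner_single_left (𝕜 := ℂ) i (1 : ℂ) (shift hσ x)
  rw [← ContinuousLinearMap.adjoint_inner_left, hsingle, inner_zero_left] at this
  simpa using this.symm

end Shift

section Oscillators

theorem tendsto_fst_add_snd_cofinite :
    Tendsto (fun p : ℕ × ℕ => p.1 + p.2) cofinite atTop := by
  refine tendsto_atTop.mpr fun n => ?_
  refine ((Set.finite_Iio n).prod (Set.finite_Iio n)).subset fun p hp => ?_
  simp only [Set.mem_compl_iff, Set.mem_ofPred_eq, not_le, Set.mem_prod, Set.mem_Iio] at hp ⊢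
  omega

theorem map_succ_id_injective : (Prod.map Nat.succ id : ℕ × ℕ → ℕ × ℕ).Injective :=
  Nat.succ_injective.prodMap Function.injective_id

theorem map_id_succ_injective : (Prod.map id Nat.succ : ℕ × ℕ → ℕ × ℕ).Injective :=
  Function.injective_id.prodMap Nat.succ_injective

variable {β : ℕ → ℂ}

theorem tendsto_comp_degree (hβ : Tendsto β atTop (𝓝 0)) :
    Tendsto (fun p : ℕ × ℕ => β (p.1 + p.2)) cofinite (𝓝 0) :=
  hβ.comp tendsto_fst_add_snd_cofinite

theorem tendsto_raisingWeight (hβ : Tendsto β atTop (𝓝 0)) {v : ℕ × ℕ → ℕ}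
    (hv : ∀ p, v p ≤ p.1 + p.2) :
    Tendsto (fun p => ((v p + 1 : ℕ) / (p.1 + p.2 + 1 : ℕ) : ℂ) * β (p.1 + p.2))
      cofinite (𝓝 0) := by
  refine squeeze_zero_norm (fun p => ?_) (tendsto_zero_iff_norm_tendsto_zero.mp
    (tendsto_comp_degree hβ))
  rw [norm_mul, norm_div, Complex.norm_natCast, Complex.norm_natCast]
  refine mul_le_of_le_one_left (norm_nonneg _) (div_le_one_of_le₀ ?_ (Nat.cast_nonneg _))
  exact_mod_cast Nat.succ_le_succ (hv p)

/-- The annihilation operator of the first of two oscillators, with the weight `β N` on vectors of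
total degree `N + 1`. -/
noncomputable def loweringFst (hβ : Tendsto β atTop (𝓝 0)) : ℓ²(ℕ × ℕ, ℂ) →L[ℂ] ℓ²(ℕ × ℕ, ℂ) :=
  diagonalOperator (tendsto_comp_degree hβ) ∘L (shift map_succ_id_injective).adjoint

/-- The annihilation operator of the second oscillator; see `loweringFst`. -/
noncomputable def loweringSnd (hβ : Tendsto β atTop (𝓝 0)) : ℓ²(ℕ × ℕ, ℂ) →L[ℂ] ℓ²(ℕ × ℕ, ℂ) :=
  diagonalOperator (tendsto_comp_degree hβ) ∘L (shift map_id_succ_injective).adjoint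

/-- The creation operator of the first of two oscillators, with the weight `β N / (N + 1)` on
vectors of total degree `N`. -/
noncomputable def raisingFst (hβ : Tendsto β atTop (𝓝 0)) : ℓ²(ℕ × ℕ, ℂ) →L[ℂ] ℓ²(ℕ × ℕ, ℂ) :=
  shift map_succ_id_injective ∘L
    diagonalOperator (tendsto_raisingWeight hβ fun p => Nat.le_add_right p.1 p.2)

/-- The creation operator of the second oscillator; see `raisingFst`. -/
noncomputable def raisingSnd (hβ : Tendsto β atTop (𝓝 0)) : ℓ²(ℕ × ℕ, ℂ) →L[ℂ] ℓ²(ℕ × ℕ, ℂ) :=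
  shift map_id_succ_injective ∘L
    diagonalOperator (tendsto_raisingWeight hβ fun p => Nat.le_add_left p.2 p.1)

variable (hβ : Tendsto β atTop (𝓝 0)) (x : ℓ²(ℕ × ℕ, ℂ)) (i j : ℕ)

theorem isCompactOperator_loweringFst : IsCompactOperator (loweringFst hβ) :=
  (isCompactOperator_diagonalOperator (tendsto_comp_degree hβ)).comp_clm _

theorem isCompactOperator_loweringSnd : IsCompactOperator (loweringSnd hβ) :=
  (isCompactOperator_diagonalOperator (tendsto_comp_degree hβ)).comp_clm _

theorem isCompactOperator_raisingFst : IsCompactOperator (raisingFst hβ) :=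
  (isCompactOperator_diagonalOperator _).clm_comp (shift map_succ_id_injective)

theorem isCompactOperator_raisingSnd : IsCompactOperator (raisingSnd hβ) :=
  (isCompactOperator_diagonalOperator _).clm_comp (shift map_id_succ_injective)

theorem loweringFst_apply : loweringFst hβ x (i, j) = β (i + j) * x (i + 1, j) := by
  simp [loweringFst]

theorem loweringSnd_apply : loweringSnd hβ x (i, j) = β (i + j) * x (i, j + 1) := by
  simp [loweringSnd]

theorem raisingFst_apply_succ : raisingFst hβ x (i + 1, j) =
    ((i + 1 : ℕ) / (i + j + 1 : ℕ) : ℂ) * β (i + j) * x (i, j) :=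
  shift_apply_self map_succ_id_injective _ (i, j)

theorem raisingFst_apply_zero : raisingFst hβ x (0, j) = 0 :=
  shift_apply_of_notMem_range map_succ_id_injective _ (by simp)

theorem raisingSnd_apply_succ : raisingSnd hβ x (i, j + 1) =
    ((j + 1 : ℕ) / (i + j + 1 : ℕ) : ℂ) * β (i + j) * x (i, j) :=
  shift_apply_self map_id_succ_injective _ (i, j)

theorem raisingSnd_apply_zero : raisingSnd hβ x (i, 0) = 0 :=
  shift_apply_of_notMem_range map_id_succ_injective _ (by simp)

theorem loweringFst_loweringSnd_comm :
    loweringFst hβ (loweringSnd hβ x) = loweringSnd hβ (loweringFst hβ x) := by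
  ext ⟨i, j⟩
  simp only [loweringFst_apply, loweringSnd_apply, add_right_comm i 1 j, add_assoc]

theorem raisingFst_raisingSnd_comm :
    raisingFst hβ (raisingSnd hβ x) = raisingSnd hβ (raisingFst hβ x) := by
  ext ⟨i, j⟩
  rcases i with _ | i <;> rcases j with _ | j <;>
    simp only [raisingFst_apply_succ, raisingFst_apply_zero, raisingSnd_apply_succ,
      raisingSnd_apply_zero, mul_zero]
  rw [← add_assoc, add_right_comm i 1 j]
  ring

theorem lowering_raising_apply :
    loweringFst hβ (raisingFst hβ x) (i, j) + loweringSnd hβ (raisingSnd hβ x) (i, j) =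
      ((i + j + 2 : ℕ) / (i + j + 1 : ℕ) : ℂ) * β (i + j) ^ 2 * x (i, j) := by
  rw [loweringFst_apply, loweringSnd_apply, raisingFst_apply_succ, raisingSnd_apply_succ]
  push_cast
  ring

variable {i j} in
theorem raisingFst_loweringFst_apply {n : ℕ} (hn : i + j = n + 1) :
    raisingFst hβ (loweringFst hβ x) (i, j) = (i / (n + 1 : ℕ) : ℂ) * β n ^ 2 * x (i, j) := by
  rcases i with _ | i
  · simp [raisingFst_apply_zero]
  · obtain rfl : i + j = n := by omega
    rw [raisingFst_apply_succ, loweringFst_apply]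
    ring

variable {i j} in
theorem raisingSnd_loweringSnd_apply {n : ℕ} (hn : i + j = n + 1) :
    raisingSnd hβ (loweringSnd hβ x) (i, j) = (j / (n + 1 : ℕ) : ℂ) * β n ^ 2 * x (i, j) := by
  rcases j with _ | j
  · simp [raisingSnd_apply_zero]
  · obtain rfl : i + j = n := by omega
    rw [raisingSnd_apply_succ, loweringSnd_apply]
    ring

theorem raising_lowering_apply_zero :
    raisingFst hβ (loweringFst hβ x) (0, 0) + raisingSnd hβ (loweringSnd hβ x) (0, 0) = 0 := by
  rw [raisingFst_apply_zero, raisingSnd_apply_zero, add_zero]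

variable {i j} in
theorem raising_lowering_apply {n : ℕ} (hn : i + j = n + 1) :
    raisingFst hβ (loweringFst hβ x) (i, j) + raisingSnd hβ (loweringSnd hβ x) (i, j) =
      β n ^ 2 * x (i, j) := by
  rw [raisingFst_loweringFst_apply hβ x hn, raisingSnd_loweringSnd_apply hβ x hn, ← hn,
    ← add_mul, ← add_mul, ← add_div, ← Nat.cast_add, div_self (Nat.cast_ne_zero.mpr (by omega)),
    one_mul]

end Oscillators

theorem isCommutatorOfCompacts_diagonalOperator_degree {β : ℕ → ℂ} (hβ : Tendsto β atTop (𝓝 0))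
    {w : ℕ → ℂ} (hw : Tendsto (fun p : ℕ × ℕ => w (p.1 + p.2)) cofinite (𝓝 0))
    (h0 : w 0 = 2 * β 0 ^ 2)
    (hsucc : ∀ n : ℕ, w (n + 1) = ((n + 3 : ℕ) / (n + 2 : ℕ) : ℂ) * β (n + 1) ^ 2 - β n ^ 2) :
    IsCommutatorOfCompacts (diagonalOperator hw) := by
  refine ⟨loweringFst hβ + raisingSnd hβ, raisingFst hβ - loweringSnd hβ,
    (isCompactOperator_loweringFst hβ).add (isCompactOperator_raisingSnd hβ),
    (isCompactOperator_raisingFst hβ).sub (isCompactOperator_loweringSnd hβ), ?_⟩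
  ext x ⟨i, j⟩
  have hcomm : ((loweringFst hβ + raisingSnd hβ) ∘L (raisingFst hβ - loweringSnd hβ) -
        (raisingFst hβ - loweringSnd hβ) ∘L (loweringFst hβ + raisingSnd hβ)) x (i, j) =
      loweringFst hβ (raisingFst hβ x) (i, j) + loweringSnd hβ (raisingSnd hβ x) (i, j) -
        (raisingFst hβ (loweringFst hβ x) (i, j) + raisingSnd hβ (loweringSnd hβ x) (i, j)) := by
    simp only [add_apply, sub_apply, lp.coeFn_sub, lp.coeFn_add, Pi.sub_apply, Pi.add_apply,
      ContinuousLinearMap.comp_apply, map_add, map_sub, loweringFst_loweringSnd_comm,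
      raisingFst_raisingSnd_comm]
    ring
  rw [hcomm, lowering_raising_apply, diagonalOperator_apply]
  dsimp only
  generalize hN : i + j = N
  rcases N with _ | N
  · obtain ⟨rfl, rfl⟩ := Nat.add_eq_zero_iff.mp hN
    rw [raising_lowering_apply_zero, h0]
    simp
  · rw [raising_lowering_apply hβ x hN, hsucc]
    ring

section OrthonormalDiagonal

variable {ι H : Type*} [NormedAddCommGroup H] [InnerProductSpace ℂ H] [CompleteSpace H]
  {e : ι → H} {w : ι → ℂ}

/-- The operator `∑ i, w i • ⟪e i, ·⟫ • e i` with eigenvectors `e i` and eigenvalues `w i`. -/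
noncomputable def orthonormalDiagonal (he : Orthonormal ℂ e) (hw : Tendsto w cofinite (𝓝 0)) :
    H →L[ℂ] H :=
  synthesis he ∘L diagonalOperator hw ∘L (synthesis he).adjoint

theorem isCompactOperator_orthonormalDiagonal (he : Orthonormal ℂ e)
    (hw : Tendsto w cofinite (𝓝 0)) : IsCompactOperator (orthonormalDiagonal he hw) :=
  ((isCompactOperator_diagonalOperator hw).comp_clm _).clm_comp (synthesis he)

theorem eq_orthonormalDiagonal (he : Orthonormal ℂ e) (hw : Tendsto w cofinite (𝓝 0))
    {T : H →L[ℂ] H} (hT : ∀ i, T (e i) = w i • e i)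
    (hT₀ : ∀ y, (∀ i, inner ℂ (e i) y = 0) → T y = 0) : T = orthonormalDiagonal he hw := by
  classical
  have hrange : T ∘L synthesis he = synthesis he ∘L diagonalOperator hw := by
    refine lp.ext_continuousLinearMap (by simp) fun i => ?_
    ext
    simp [synthesis_single, diagonalOperator_single, hT]
  ext y
  have hperp : T (y - synthesis he ((synthesis he).adjoint y)) = 0 := hT₀ _ fun i => by
    rw [← adjoint_synthesis_apply he, map_sub, ← ContinuousLinearMap.comp_apply,
      adjoint_synthesis_comp_synthesis, ContinuousLinearMap.id_apply, sub_self]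
    rfl
  rw [map_sub, sub_eq_zero] at hperp
  rw [hperp]
  exact DFunLike.congr_fun hrange _

theorem IsCommutatorOfCompacts.conj_synthesis (he : Orthonormal ℂ e)
    {S : ℓ²(ι, ℂ) →L[ℂ] ℓ²(ι, ℂ)} (hS : IsCommutatorOfCompacts S) :
    IsCommutatorOfCompacts (synthesis he ∘L S ∘L (synthesis he).adjoint) := by
  obtain ⟨C, Z, hC, hZ, rfl⟩ := hS
  refine ⟨synthesis he ∘L C ∘L (synthesis he).adjoint, synthesis he ∘L Z ∘L (synthesis he).adjoint,
    (hC.comp_clm _).clm_comp (synthesis he), (hZ.comp_clm _).clm_comp (synthesis he), ?_⟩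
  have hcancel (x : ℓ²(ι, ℂ)) : (synthesis he).adjoint (synthesis he x) = x :=
    DFunLike.congr_fun (adjoint_synthesis_comp_synthesis he) x
  ext y
  simp [hcancel]

end OrthonormalDiagonal

/-- `(d 1, d 2 - d 1, d 3 - d 2, …)`, indexed from `1`. -/
def increments (d : ℕ → ℝ) (n : ℕ) : ℝ := if n = 1 then d 1 else d n - d (n - 1)

theorem increments_one (d : ℕ → ℝ) : increments d 1 = d 1 :=
  if_pos rfl

theorem increments_add_two (d : ℕ → ℝ) (n : ℕ) : increments d (n + 2) = d (n + 2) - d (n + 1) :=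
  if_neg (by omega)

theorem tendsto_increments_div {d : ℕ → ℝ} (hd : Tendsto (fun n : ℕ => d n / n) atTop (𝓝 0)) :
    Tendsto (fun n : ℕ => increments d n / n) atTop (𝓝 0) := by
  rw [← tendsto_add_atTop_iff_nat 2]
  have hratio : Tendsto (fun n : ℕ => ((n + 1 : ℕ) : ℝ) / ((n + 1 : ℕ) + 1)) atTop (𝓝 1) :=
    (tendsto_natCast_div_add_atTop (1 : ℝ)).comp (tendsto_add_atTop_nat 1)
  have := (hd.comp (tendsto_add_atTop_nat 2)).sub ((hd.comp (tendsto_add_atTop_nat 1)).mul hratio)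
  simp only [zero_mul, sub_zero] at this
  refine this.congr fun n => ?_
  simp only [Function.comp_apply, increments_add_two]
  push_cast
  field_simp
  ring

theorem tendsto_degreeWeight {d : ℕ → ℝ} (hd : Tendsto (fun n : ℕ => d n / n) atTop (𝓝 0)) :
    Tendsto (fun p : ℕ × ℕ =>
      ((increments d (p.1 + p.2 + 1) / (p.1 + p.2 + 1 : ℕ) : ℝ) : ℂ)) cofinite (𝓝 0) := by
  have := ((tendsto_increments_div hd).comp
    ((tendsto_add_atTop_nat 1).comp tendsto_fst_add_snd_cofinite)).ofReal
  rwa [Complex.ofReal_zero] at this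

theorem isCommutatorOfCompacts_diagonalOperator_increments {d : ℕ → ℝ}
    (hd : Tendsto (fun n : ℕ => d n / n) atTop (𝓝 0)) :
    IsCommutatorOfCompacts (diagonalOperator (tendsto_degreeWeight hd)) := by
  choose β hβ using fun N : ℕ =>
    IsAlgClosed.exists_pow_nat_eq ((d (N + 1) : ℂ) / (N + 2 : ℕ)) two_pos
  have hβ_lim : Tendsto β atTop (𝓝 0) := by
    have hnorm (N : ℕ) : ‖β N‖ ^ 2 ≤ |d (N + 1) / (N + 1 : ℕ)| := by
      rw [← norm_pow, hβ, norm_div, Complex.norm_real, Complex.norm_natCast, abs_div, Nat.abs_cast,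
        Real.norm_eq_abs]
      gcongr
      omega
    refine squeeze_zero_norm (fun N => Real.le_sqrt_of_sq_le (hnorm N)) ?_
    have := (hd.comp (tendsto_add_atTop_nat 1)).abs.sqrt
    rwa [abs_zero, Real.sqrt_zero] at this
  refine isCommutatorOfCompacts_diagonalOperator_degree hβ_lim
    (w := fun N => ((increments d (N + 1) / (N + 1 : ℕ) : ℝ) : ℂ)) _ ?_ fun N => ?_
  · simp [hβ, increments_one, mul_div_cancel₀]
  · rw [hβ, hβ, increments_add_two]
    have hN : (N : ℂ) + 1 + 2 ≠ 0 := by norm_cast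
    push_cast
    field_simp
    ring

section Blocks

theorem blockNumber_eq_succ_iff (k m : ℕ) :
    blockNumber k = m + 1 ↔ k ∈ Finset.Ico (m * (m + 1) / 2) (m * (m + 1) / 2 + (m + 1)) := by
  have hstep (n : ℕ) : (n + 1) * (n + 1 + 1) / 2 = n * (n + 1) / 2 + (n + 1) := by
    rw [show (n + 1) * (n + 1 + 1) = n * (n + 1) + (n + 1) * 2 by ring,
      Nat.add_mul_div_right _ _ two_pos]
  have hmono : Monotone fun n : ℕ => n * (n + 1) / 2 :=
    monotone_nat_of_le_succ fun n => by simp only [hstep]; omega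
  rw [blockNumber, Nat.find_eq_iff, Finset.mem_Ico, hstep, and_comm]
  refine and_congr_left fun _ => ⟨fun h => ?_, fun h n hn => ?_⟩
  · exact not_lt.mp (h m (Nat.lt_succ_self m))
  · exact not_lt.mpr ((hmono (Nat.lt_succ_iff.mp hn)).trans h)

theorem blockNumber_pos (k : ℕ) : 0 < blockNumber k := by
  rw [Nat.pos_iff_ne_zero, blockNumber, Ne, Nat.find_eq_zero]
  simp

theorem blockNumber_eq_one_iff (k : ℕ) : blockNumber k = 1 ↔ k = 0 := by
  rw [blockNumber_eq_succ_iff k 0]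
  simp

theorem exists_equiv_blockNumber :
    ∃ φ : ℕ ≃ ℕ × ℕ, ∀ k, (φ k).1 + (φ k).2 + 1 = blockNumber k := by
  have hfiber (n : ℕ) :
      Nonempty ({k // blockNumber k = n} ≃ {p : ℕ × ℕ // p.1 + p.2 + 1 = n}) := by
    rcases n with _ | m
    · have : IsEmpty {k // blockNumber k = 0} := ⟨fun k => (blockNumber_pos k.1).ne' k.2⟩
      have : IsEmpty {p : ℕ × ℕ // p.1 + p.2 + 1 = 0} := ⟨fun p => Nat.succ_ne_zero _ p.2⟩
      exact ⟨Equiv.equivOfIsEmpty _ _⟩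
    · have e₁ := Equiv.subtypeEquivRight fun k => blockNumber_eq_succ_iff k m
      have e₂ : {p : ℕ × ℕ // p ∈ Finset.HasAntidiagonal.antidiagonal m} ≃
          {p : ℕ × ℕ // p.1 + p.2 + 1 = m + 1} :=
        Equiv.subtypeEquivRight fun p => by simp
      exact ⟨e₁.trans ((Finset.equivOfCardEq (by simp)).trans e₂)⟩
  exact ⟨Equiv.ofFiberEquiv fun n => (hfiber n).some, fun k =>
    Equiv.ofFiberEquiv_map (g := fun p : ℕ × ℕ => p.1 + p.2 + 1) _ k⟩

theorem tendsto_blockNumber : Tendsto blockNumber cofinite atTop := by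
  obtain ⟨φ, hφ⟩ := exists_equiv_blockNumber
  exact ((tendsto_add_atTop_nat 1).comp
    (tendsto_fst_add_snd_cofinite.comp φ.injective.tendsto_cofinite)).congr hφ

end Blocks

section Increments

variable (d : ℕ → ℝ)

theorem sum_increments {n : ℕ} (hn : 1 ≤ n) : ∑ j ∈ Finset.Icc 1 n, increments d j = d n := by
  induction n, hn using Nat.le_induction with
  | base => simp [increments_one]
  | succ n hn ih =>
    obtain ⟨m, rfl⟩ := Nat.exists_eq_add_of_le' hn
    rw [Finset.sum_Icc_succ_top (by omega), ih, increments_add_two]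
    ring

theorem increments_sum {n : ℕ} (hn : 1 ≤ n) :
    increments (fun n => ∑ j ∈ Finset.Icc 1 n, d j) n = d n := by
  rcases n with _ | _ | n
  · omega
  · simp [increments_one]
  · rw [increments_add_two, Finset.sum_Icc_succ_top (by omega)]
    ring

theorem incrementEigenvalues_apply (k : ℕ) :
    incrementEigenvalues d k = increments d (blockNumber k) / blockNumber k := by
  by_cases hk : blockNumber k = 1 <;> simp [incrementEigenvalues, repeatBlocks, increments, hk]

theorem incrementEigenvalues_eq_directEigenvalues :
    incrementEigenvalues d = directEigenvalues (increments d) :=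
  funext (incrementEigenvalues_apply d)

theorem directEigenvalues_eq_incrementEigenvalues :
    directEigenvalues d = incrementEigenvalues fun n => ∑ j ∈ Finset.Icc 1 n, d j := by
  funext k
  rw [incrementEigenvalues_apply, increments_sum d (blockNumber_pos k)]
  rfl

variable {d}

theorem tendsto_incrementEigenvalues (hd : Tendsto (fun n : ℕ => d n / n) atTop (𝓝 0)) :
    Tendsto (fun k => (incrementEigenvalues d k : ℂ)) cofinite (𝓝 0) := by
  simp only [incrementEigenvalues_apply]
  have := ((tendsto_increments_div hd).comp tendsto_blockNumber).ofReal
  rwa [Complex.ofReal_zero] at this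

theorem IncrementCondition.increments_nonneg (hd : IncrementCondition d) {n : ℕ} (hn : 1 ≤ n) :
    0 ≤ increments d n := by
  rcases n with _ | _ | n
  · omega
  · exact (hd.1 1 le_rfl).trans_eq (increments_one d).symm
  · rw [increments_add_two]
    exact sub_nonneg.mpr (hd.2.1 (n + 1) (by omega))

theorem IncrementCondition.meanCondition (hd : IncrementCondition d) :
    MeanCondition (increments d) := by
  refine ⟨fun n => hd.increments_nonneg, hd.2.2.congr' ?_⟩
  filter_upwards [eventually_ge_atTop 1] with n hn
  rw [sum_increments d hn]
  ring

theorem MeanCondition.incrementCondition (hd : MeanCondition d) :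
    IncrementCondition fun n => ∑ j ∈ Finset.Icc 1 n, d j := by
  refine ⟨fun n _ => Finset.sum_nonneg fun j hj => hd.1 j (Finset.mem_Icc.mp hj).1, fun n _ => ?_,
    hd.2.congr fun n => by ring⟩
  dsimp only
  rw [Finset.sum_Icc_succ_top (by omega)]
  exact le_add_of_nonneg_right (hd.1 _ (by omega))

theorem exists_incrementCondition_iff_exists_meanCondition (s : ℕ → ℝ) :
    (∃ d, IncrementCondition d ∧ s = incrementEigenvalues d) ↔
      ∃ d, MeanCondition d ∧ s = directEigenvalues d := by
  constructor
  · rintro ⟨d, hd, rfl⟩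
    exact ⟨_, hd.meanCondition, incrementEigenvalues_eq_directEigenvalues d⟩
  · rintro ⟨d, hd, rfl⟩
    exact ⟨_, hd.incrementCondition, directEigenvalues_eq_incrementEigenvalues d⟩

theorem incrementEigenvalues_pos (hd : ∀ n, 1 ≤ n → d n < d (n + 1)) {k : ℕ} (hk : k ≠ 0) :
    0 < incrementEigenvalues d k := by
  rw [incrementEigenvalues_apply]
  obtain ⟨n, hn⟩ : ∃ n, blockNumber k = n + 2 := by
    have := blockNumber_pos k
    have := (blockNumber_eq_one_iff k).not.mpr hk
    exact Nat.exists_eq_add_of_le' (by omega)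
  rw [hn, increments_add_two]
  exact div_pos (sub_pos.mpr (hd _ (by omega))) (by positivity)

variable (d) in
theorem incrementEigenvalues_zero : incrementEigenvalues d 0 = d 1 := by
  rw [incrementEigenvalues_apply, (blockNumber_eq_one_iff 0).mpr rfl, increments_one, Nat.cast_one,
    div_one]

end Increments

section InfiniteDimensional

variable {𝕜 E : Type*} [RCLike 𝕜] [NormedAddCommGroup E] [InnerProductSpace 𝕜 E]

theorem infinite_of_hilbertBasis {ι : Type*} (b : HilbertBasis ι 𝕜 E)
    (hE : ¬ FiniteDimensional 𝕜 E) : Infinite ι := by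
  by_contra hι
  rw [not_infinite_iff_finite] at hι
  have := Fintype.ofFinite ι
  exact hE b.toOrthonormalBasis.toBasis.finiteDimensional_of_finite

theorem exists_orthonormal_of_card_le_rank [CompleteSpace E] {α : Type*} [Countable α]
    (hα : ENat.card α ≤ Cardinal.toENat (Module.rank 𝕜 E)) : ∃ f : α → E, Orthonormal 𝕜 f := by
  by_cases hE : FiniteDimensional 𝕜 E
  · rw [← Module.finrank_eq_rank, Cardinal.toENat_nat] at hα
    have := ENat.card_lt_top.mp (hα.trans_lt (ENat.natCast_lt_top _))
    have := Fintype.ofFinite α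
    rw [ENat.card_eq_coe_fintype_card, Nat.cast_le] at hα
    obtain ⟨g⟩ : Nonempty (α ↪ Fin (Module.finrank 𝕜 E)) :=
      Function.Embedding.nonempty_of_card_le (by simpa using hα)
    exact ⟨_, (stdOrthonormalBasis 𝕜 E).orthonormal.comp g g.injective⟩
  · obtain ⟨w, b, -⟩ := exists_hilbertBasis 𝕜 E
    have := infinite_of_hilbertBasis b hE
    obtain ⟨g, hg⟩ := exists_injective_nat α
    exact ⟨_, b.orthonormal.comp _ ((Infinite.natEmbedding w).injective.comp hg)⟩

theorem countable_of_orthonormal [TopologicalSpace.SeparableSpace E] {ι : Type*} {v : ι → E}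
    (hv : Orthonormal 𝕜 v) : Countable ι := by
  have hdist : Pairwise fun i j => (1 : ℝ) ≤ dist (v i) (v j) := by
    intro i j hij
    have h : ‖v i - v j‖ ^ 2 = 2 := by
      rw [@norm_sub_sq 𝕜, hv.1, hv.1, hv.2 hij, map_zero]
      norm_num
    rw [dist_eq_norm]
    nlinarith [norm_nonneg (v i - v j)]
  have hdisj : Pairwise (Function.onFun Disjoint fun i => Metric.ball (v i) (1 / 2)) :=
    fun i j hij => Metric.ball_disjoint_ball (by linarith [hdist hij])
  exact Pairwise.countable_of_isOpen_disjoint hdisj (fun i => Metric.isOpen_ball)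
    fun i => ⟨v i, Metric.mem_ball_self (by norm_num)⟩

theorem nonempty_hilbertBasis_nat [CompleteSpace E] [TopologicalSpace.SeparableSpace E]
    (hE : ¬ FiniteDimensional 𝕜 E) : Nonempty (HilbertBasis ℕ 𝕜 E) := by
  obtain ⟨w, b, -⟩ := exists_hilbertBasis 𝕜 E
  have := infinite_of_hilbertBasis b hE
  have := countable_of_orthonormal b.orthonormal
  obtain ⟨g⟩ := nonempty_equiv_of_countable (α := ℕ) (β := w)
  refine ⟨HilbertBasis.mk (b.orthonormal.comp g g.injective) ?_⟩
  rw [g.surjective.range_comp, b.dense_span]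

end InfiniteDimensional

section Spectral

open Module.End (eigenspace mem_eigenspace_iff)

theorem apply_eq_zero_of_orthogonal_eigenspaces {𝕜 E : Type*} [RCLike 𝕜] [NormedAddCommGroup E]
    [InnerProductSpace 𝕜 E] [CompleteSpace E] {T : E →L[𝕜] E} (hT : T.IsSymmetric)
    (hc : IsCompactOperator T) {y : E}
    (hy : ∀ μ : 𝕜, μ ≠ 0 → y ∈ (eigenspace (T : E →ₗ[𝕜] E) μ)ᗮ) : T y = 0 := by
  have hTy : T y ∈ (⨆ μ, eigenspace (T : E →ₗ[𝕜] E) μ)ᗮ := by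
    rw [← Submodule.iInf_orthogonal, Submodule.mem_iInf]
    intro μ x hx
    have hxy : inner 𝕜 x (T y) = inner 𝕜 (μ • x) y := by
      rw [← mem_eigenspace_iff.mp hx]
      exact (hT x y).symm
    rw [hxy, inner_smul_left]
    by_cases hμ : μ = 0
    · rw [hμ, map_zero, zero_mul]
    · rw [hy μ hμ x hx, mul_zero]
  rwa [ContinuousLinearMap.orthogonalComplement_iSup_eigenspaces_eq_bot hc hT,
    Submodule.mem_bot] at hTy

variable {H : Type*} [NormedAddCommGroup H] [InnerProductSpace ℂ H] {T : H →L[ℂ] H} {s : ℕ → ℝ}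

theorem HasEigenvalueSequence.encard_le_rank_eigenspace (hs : HasEigenvalueSequence T s) (μ : ℂ) :
    {k | (s k : ℂ) = μ}.encard ≤
      Cardinal.toENat (Module.rank ℂ (eigenspace (T : H →ₗ[ℂ] H) μ)) := by
  obtain rfl | hμ := eq_or_ne μ 0
  · rw [Module.End.eigenspace_zero]
    simpa only [Complex.ofReal_eq_zero] using hs.2
  · exact (hs.1 μ hμ).le

theorem HasEigenvalueSequence.span_eq_top [CompleteSpace H] (hs : HasEigenvalueSequence T s)
    (hc : IsCompactOperator T) {μ : ℂ} (hμ : μ ≠ 0)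
    {f : {k | (s k : ℂ) = μ} → eigenspace (T : H →ₗ[ℂ] H) μ} (hf : Orthonormal ℂ f) :
    Submodule.span ℂ (Set.range f) = ⊤ := by
  have := ContinuousLinearMap.finite_dimensional_eigenspace hc μ hμ
  have hcard := hs.1 μ hμ
  rw [← Module.finrank_eq_rank, Cardinal.toENat_nat] at hcard
  have hfin : {k | (s k : ℂ) = μ}.Finite :=
    Set.encard_lt_top_iff.mp (hcard.trans_lt (ENat.natCast_lt_top _))
  have := hfin.fintype
  rw [Set.encard_eq_coe_toFinset_card, Set.toFinset_card, Nat.cast_inj] at hcard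
  exact hf.linearIndependent.span_eq_top_of_card_eq_finrank' hcard

theorem HasEigenvalueSequence.exists_orthonormal [CompleteSpace H]
    (hs : HasEigenvalueSequence T s) (hT : T.IsSymmetric) (hc : IsCompactOperator T) :
    ∃ e : ℕ → H, Orthonormal ℂ e ∧ (∀ k, T (e k) = (s k : ℂ) • e k) ∧
      ∀ y, (∀ k, inner ℂ (e k) y = 0) → T y = 0 := by
  choose f hf using fun μ => exists_orthonormal_of_card_le_rank (hs.encard_le_rank_eigenspace μ)
  let e (k : ℕ) : H := f (s k) ⟨k, rfl⟩
  have he : Orthonormal ℂ e :=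
    (hT.orthogonalFamily_eigenspaces.orthonormal_sigma_orthonormal hf).comp
      (fun k => ⟨(s k : ℂ), k, rfl⟩) fun _ _ hkl => congrArg (fun p => (p.2 : ℕ)) hkl
  refine ⟨e, he, fun k => mem_eigenspace_iff.mp (f (s k) ⟨k, rfl⟩).2, fun y hy =>
    apply_eq_zero_of_orthogonal_eigenspaces hT hc fun μ hμ x hx => ?_⟩
  have hspan : Submodule.span ℂ (Set.range (f μ)) ≤
      (ℂ ∙ y)ᗮ.comap (eigenspace (T : H →ₗ[ℂ] H) μ).subtype := by
    rw [Submodule.span_le, Set.range_subset_iff]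
    rintro ⟨k, rfl⟩
    exact Submodule.mem_orthogonal_singleton_iff_inner_left.mpr (hy k)
  rw [hs.span_eq_top hc hμ (hf μ)] at hspan
  exact Submodule.mem_orthogonal_singleton_iff_inner_left.mp (hspan (x := ⟨x, hx⟩) trivial)

theorem isCommutatorOfCompacts_of_hasEigenvalueSequence_incrementEigenvalues [CompleteSpace H]
    {d : ℕ → ℝ} (hd : Tendsto (fun n : ℕ => d n / n) atTop (𝓝 0)) (hT : T.IsSymmetric)
    (hc : IsCompactOperator T) (hs : HasEigenvalueSequence T (incrementEigenvalues d)) :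
    IsCommutatorOfCompacts T := by
  obtain ⟨e, he, heT, hker⟩ := hs.exists_orthonormal hT hc
  obtain ⟨φ, hφ⟩ := exists_equiv_blockNumber
  have heφ : Orthonormal ℂ (e ∘ φ.symm) := he.comp _ φ.symm.injective
  have hdiag : T = orthonormalDiagonal heφ (tendsto_degreeWeight hd) := by
    refine eq_orthonormalDiagonal heφ _ (fun p => ?_) fun y hy => hker y fun k => ?_
    · have hp := hφ (φ.symm p)
      rw [Equiv.apply_symm_apply] at hp
      rw [hp, ← incrementEigenvalues_apply]
      exact heT (φ.symm p)
    · simpa using hy (φ k)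
  rw [hdiag]
  exact (isCommutatorOfCompacts_diagonalOperator_increments hd).conj_synthesis heφ

end Spectral

section Existence

open Module.End (eigenspace mem_eigenspace_iff)

variable {ι H : Type*} [NormedAddCommGroup H] [InnerProductSpace ℂ H] [CompleteSpace H]

section Positivity

variable {s : ι → ℝ}

theorem hasSum_inner_diagonalOperator (hs : Tendsto (fun i => (s i : ℂ)) cofinite (𝓝 0))
    (x : ℓ²(ι, ℂ)) :
    HasSum (fun i => ((s i * ‖x i‖ ^ 2 : ℝ) : ℂ)) (inner ℂ (diagonalOperator hs x) x) := by
  refine (lp.hasSum_inner (𝕜 := ℂ) (diagonalOperator hs x) x).congr_fun fun i => ?_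
  rw [diagonalOperator_apply, RCLike.inner_apply, map_mul, Complex.conj_ofReal, mul_left_comm,
    Complex.mul_conj, Complex.normSq_eq_norm_sq, ← Complex.ofReal_mul]

theorem isPositive_diagonalOperator (hs : Tendsto (fun i => (s i : ℂ)) cofinite (𝓝 0))
    (hs₀ : ∀ i, 0 ≤ s i) : (diagonalOperator hs).IsPositive := by
  refine (ContinuousLinearMap.isPositive_iff_complex _).mpr fun x => ?_
  obtain ⟨hre, him⟩ := (Complex.hasSum_iff _ _).mp (hasSum_inner_diagonalOperator hs x)
  simp only [Complex.ofReal_re, Complex.ofReal_im] at hre him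
  exact ⟨Complex.ext rfl (hasSum_zero.unique him),
    hre.nonneg fun i => mul_nonneg (hs₀ i) (sq_nonneg _)⟩

theorem isPositive_orthonormalDiagonal {e : ι → H} (he : Orthonormal ℂ e)
    (hs : Tendsto (fun i => (s i : ℂ)) cofinite (𝓝 0)) (hs₀ : ∀ i, 0 ≤ s i) :
    (orthonormalDiagonal he hs).IsPositive :=
  (isPositive_diagonalOperator hs hs₀).conj_adjoint (synthesis he)

theorem isStrictlyPositiveOperator_orthonormalDiagonal (b : HilbertBasis ι ℂ H)
    (hs : Tendsto (fun i => (s i : ℂ)) cofinite (𝓝 0)) (hs₀ : ∀ i, 0 < s i) :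
    IsStrictlyPositiveOperator (orthonormalDiagonal b.orthonormal hs) := by
  refine ⟨isPositive_orthonormalDiagonal b.orthonormal hs fun i => (hs₀ i).le, fun x hx => ?_⟩
  obtain ⟨i, hi⟩ : ∃ i, inner ℂ (b i) x ≠ 0 := by
    by_contra! h
    exact hx (b.repr.map_eq_zero_iff.mp (by ext i; simpa [b.repr_apply_apply] using h i))
  have hsum := Complex.hasSum_re
    (hasSum_inner_diagonalOperator hs ((synthesis b.orthonormal).adjoint x))
  rw [ContinuousLinearMap.adjoint_inner_right] at hsum
  simp only [Complex.ofReal_re, adjoint_synthesis_apply] at hsum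
  have hi' : 0 < s i * ‖inner ℂ (b i) x‖ ^ 2 := mul_pos (hs₀ i) (by positivity)
  exact hi'.trans_le (le_hasSum hsum i fun j _ => mul_nonneg (hs₀ j).le (sq_nonneg _))

end Positivity

variable {w : ι → ℂ} {μ : ℂ}

theorem inner_orthonormalDiagonal {e : ι → H} (he : Orthonormal ℂ e)
    (hw : Tendsto w cofinite (𝓝 0)) (x : H) (i : ι) :
    inner ℂ (e i) (orthonormalDiagonal he hw x) = w i * inner ℂ (e i) x := by
  rw [← adjoint_synthesis_apply he, orthonormalDiagonal, ← ContinuousLinearMap.comp_apply,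
    ← ContinuousLinearMap.comp_assoc, adjoint_synthesis_comp_synthesis,
    ContinuousLinearMap.id_comp, ContinuousLinearMap.comp_apply, diagonalOperator_apply,
    adjoint_synthesis_apply]

theorem mem_eigenspace_orthonormalDiagonal_iff (b : HilbertBasis ι ℂ H)
    (hw : Tendsto w cofinite (𝓝 0)) {x : H} :
    x ∈ eigenspace (orthonormalDiagonal b.orthonormal hw : H →ₗ[ℂ] H) μ ↔
      ∀ i, w i ≠ μ → inner ℂ (b i) x = 0 := by
  rw [mem_eigenspace_iff, ContinuousLinearMap.coe_coe, ← b.repr.injective.eq_iff, lp.ext_iff,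
    funext_iff]
  refine forall_congr' fun i => ?_
  rw [b.repr_apply_apply, b.repr_apply_apply, inner_orthonormalDiagonal, inner_smul_right,
    mul_eq_mul_right_iff]
  tauto

theorem eigenspace_orthonormalDiagonal (b : HilbertBasis ι ℂ H) (hw : Tendsto w cofinite (𝓝 0))
    (hμ : {i | w i = μ}.Finite) :
    eigenspace (orthonormalDiagonal b.orthonormal hw : H →ₗ[ℂ] H) μ =
      Submodule.span ℂ (b '' {i | w i = μ}) := by
  refine le_antisymm (fun x hx => ?_) (Submodule.span_le.mpr ?_)
  · rw [mem_eigenspace_orthonormalDiagonal_iff] at hx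
    have hsum : x = ∑ i ∈ hμ.toFinset, b.repr x i • b i :=
      (b.hasSum_repr x).unique (hasSum_sum_of_ne_finset_zero fun i hi => by
        rw [b.repr_apply_apply, hx i (by simpa using hi), zero_smul])
    rw [hsum]
    exact Submodule.sum_mem _ fun i hi => Submodule.smul_mem _ _
      (Submodule.subset_span ⟨i, by simpa using hi, rfl⟩)
  · rintro _ ⟨j, rfl, rfl⟩
    refine (mem_eigenspace_orthonormalDiagonal_iff b hw).mpr fun i hi => b.orthonormal.2 ?_
    exact fun hij => hi (congrArg w hij)

theorem rank_eigenspace_orthonormalDiagonal (b : HilbertBasis ι ℂ H)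
    (hw : Tendsto w cofinite (𝓝 0)) (hμ : {i | w i = μ}.Finite) :
    Cardinal.toENat (Module.rank ℂ
      (eigenspace (orthonormalDiagonal b.orthonormal hw : H →ₗ[ℂ] H) μ)) =
        {i | w i = μ}.encard := by
  have hli := b.orthonormal.linearIndependent
  rw [eigenspace_orthonormalDiagonal b hw hμ,
    rank_span_set (hli.linearIndepOn_id.mono (Set.image_subset_range _ _)),
    ← hli.injective.encard_image]
  rfl

theorem rank_ker_orthonormalDiagonal (b : HilbertBasis ι ℂ H) {s : ι → ℝ}
    (hs : Tendsto (fun i => (s i : ℂ)) cofinite (𝓝 0)) (hs₀ : {i | s i = 0}.Finite) :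
    Cardinal.toENat (Module.rank ℂ
      (LinearMap.ker (orthonormalDiagonal b.orthonormal hs : H →ₗ[ℂ] H))) =
        {i | s i = 0}.encard := by
  rw [← Module.End.eigenspace_zero,
    rank_eigenspace_orthonormalDiagonal b hs (by simpa using hs₀)]
  simp only [Complex.ofReal_eq_zero]

theorem hasEigenvalueSequence_orthonormalDiagonal (b : HilbertBasis ℕ ℂ H) {s : ℕ → ℝ}
    (hs : Tendsto (fun k => (s k : ℂ)) cofinite (𝓝 0)) (hs₀ : {k | s k = 0}.Finite) :
    HasEigenvalueSequence (orthonormalDiagonal b.orthonormal hs) s :=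
  ⟨fun μ hμ => (rank_eigenspace_orthonormalDiagonal b hs (by
      simpa [Filter.eventually_cofinite] using hs.eventually_ne hμ.symm)).symm,
    (rank_ker_orthonormalDiagonal b hs hs₀).ge⟩

variable [TopologicalSpace.SeparableSpace H] {d : ℕ → ℝ}

theorem exists_isStrictlyPositiveOperator_incrementEigenvalues (hH : ¬ FiniteDimensional ℂ H)
    (hd : Tendsto (fun n : ℕ => d n / n) atTop (𝓝 0)) (h1 : 0 < d 1)
    (hlt : ∀ n, 1 ≤ n → d n < d (n + 1)) :
    ∃ T : H →L[ℂ] H, IsStrictlyPositiveOperator T ∧ IsCompactOperator T ∧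
      HasEigenvalueSequence T (incrementEigenvalues d) ∧ IsCommutatorOfCompacts T := by
  obtain ⟨b⟩ := nonempty_hilbertBasis_nat hH
  have hs := tendsto_incrementEigenvalues hd
  have hpos (k : ℕ) : 0 < incrementEigenvalues d k := by
    rcases k with _ | k
    · rwa [incrementEigenvalues_zero]
    · exact incrementEigenvalues_pos hlt k.succ_ne_zero
  have hT := isStrictlyPositiveOperator_orthonormalDiagonal b hs hpos
  have hTc := isCompactOperator_orthonormalDiagonal b.orthonormal hs
  have hTs := hasEigenvalueSequence_orthonormalDiagonal b hs (by simp [(hpos _).ne'])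
  exact ⟨_, hT, hTc, hTs, isCommutatorOfCompacts_of_hasEigenvalueSequence_incrementEigenvalues hd
    hT.1.isSymmetric hTc hTs⟩

theorem exists_isPositive_incrementEigenvalues_finrank_ker_eq_one (hH : ¬ FiniteDimensional ℂ H)
    (hd : Tendsto (fun n : ℕ => d n / n) atTop (𝓝 0)) (h1 : d 1 = 0)
    (hlt : ∀ n, 1 ≤ n → d n < d (n + 1)) :
    ∃ T : H →L[ℂ] H, T.IsPositive ∧ IsCompactOperator T ∧
      HasEigenvalueSequence T (incrementEigenvalues d) ∧
      Module.finrank ℂ (LinearMap.ker (T : H →ₗ[ℂ] H)) = 1 ∧ IsCommutatorOfCompacts T := by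
  obtain ⟨b⟩ := nonempty_hilbertBasis_nat hH
  have hs := tendsto_incrementEigenvalues hd
  have hs₀ : incrementEigenvalues d 0 = 0 := (incrementEigenvalues_zero d).trans h1
  have hzero : {k | incrementEigenvalues d k = 0} = {0} := by
    ext k
    refine ⟨fun hk => ?_, fun hk => hk ▸ hs₀⟩
    by_contra hne
    exact (incrementEigenvalues_pos hlt hne).ne' hk
  have hfin : {k | incrementEigenvalues d k = 0}.Finite := hzero ▸ Set.finite_singleton 0
  have hnonneg (k : ℕ) : 0 ≤ incrementEigenvalues d k := by
    obtain rfl | hk := eq_or_ne k 0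
    · exact hs₀.ge
    · exact (incrementEigenvalues_pos hlt hk).le
  have hT := isPositive_orthonormalDiagonal b.orthonormal hs hnonneg
  have hTc := isCompactOperator_orthonormalDiagonal b.orthonormal hs
  have hTs := hasEigenvalueSequence_orthonormalDiagonal b hs hfin
  have hrank := rank_ker_orthonormalDiagonal b hs hfin
  rw [hzero, Set.encard_singleton] at hrank
  refine ⟨_, hT, hTc, hTs, ?_, isCommutatorOfCompacts_of_hasEigenvalueSequence_incrementEigenvalues
    hd hT.isSymmetric hTc hTs⟩
  rw [Module.finrank, ← Cardinal.toNat_toENat, hrank, ENat.toNat_one]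

end Existence

section Examples

theorem incrementCondition_sqrt : IncrementCondition fun n => √(n : ℝ) := by
  refine ⟨fun n _ => Real.sqrt_nonneg _, fun n _ => Real.sqrt_le_sqrt (by simp), ?_⟩
  simp only [Real.sqrt_div_self]
  have := (Real.tendsto_sqrt_atTop.comp (tendsto_natCast_atTop_atTop (R := ℝ))).inv_tendsto_atTop
  exact this.congr fun n => by simp

theorem incrementCondition_log : IncrementCondition fun n => Real.log n :=
  ⟨fun n _ => Real.log_natCast_nonneg n,
    fun n hn => Real.log_le_log (by exact_mod_cast hn) (by simp),
    Real.isLittleO_log_id_atTop.tendsto_div_nhds_zero.comp tendsto_natCast_atTop_atTop⟩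

theorem incrementCondition_log_add_one : IncrementCondition fun n => Real.log (n + 1) := by
  refine ⟨fun n _ => Real.log_nonneg (by simp),
    fun n _ => Real.log_le_log (by positivity) (by simp), ?_⟩
  have hadd : (fun x : ℝ => x + 1) =O[atTop] id :=
    (Asymptotics.isBigO_refl id atTop).add (Asymptotics.isLittleO_const_id_atTop 1).isBigO
  have hlog : (fun x : ℝ => Real.log (x + 1)) =o[atTop] id :=
    (Real.isLittleO_log_id_atTop.comp_tendsto
      (tendsto_atTop_add_const_right _ 1 tendsto_id)).trans_isBigO hadd
  exact hlog.tendsto_div_nhds_zero.comp tendsto_natCast_atTop_atTop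

end Examples

theorem theorem3p1_general {H : Type*} [NormedAddCommGroup H] [InnerProductSpace ℂ H]
    [CompleteSpace H] [TopologicalSpace.SeparableSpace H] (hH : ¬ FiniteDimensional ℂ H) :
    (∀ d : ℕ → ℝ, Tendsto (fun n : ℕ => d n / n) atTop (𝓝 0) → ∀ T : H →L[ℂ] H, T.IsSymmetric →
      IsCompactOperator T → HasEigenvalueSequence T (incrementEigenvalues d) →
      IsCommutatorOfCompacts T) ∧
    (∀ d : ℕ → ℝ, Tendsto (fun n : ℕ => (1 / (n : ℝ)) * ∑ j ∈ Finset.Icc 1 n, d j) atTop (𝓝 0) →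
      ∀ T : H →L[ℂ] H, T.IsSymmetric → IsCompactOperator T →
      HasEigenvalueSequence T (directEigenvalues d) → IsCommutatorOfCompacts T) ∧
    (∀ s : ℕ → ℝ, (∃ d, IncrementCondition d ∧ s = incrementEigenvalues d) ↔
      ∃ d, MeanCondition d ∧ s = directEigenvalues d) ∧
    (IncrementCondition (fun n => Real.sqrt n) ∧
      ∃ T : H →L[ℂ] H, IsStrictlyPositiveOperator T ∧ IsCompactOperator T ∧
        HasEigenvalueSequence T (incrementEigenvalues fun n => Real.sqrt n) ∧
        IsCommutatorOfCompacts T) ∧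
    (IncrementCondition (fun n => Real.log (n + 1)) ∧
      ∃ T : H →L[ℂ] H, IsStrictlyPositiveOperator T ∧ IsCompactOperator T ∧
        HasEigenvalueSequence T (incrementEigenvalues fun n => Real.log (n + 1)) ∧
        IsCommutatorOfCompacts T) ∧
    (IncrementCondition (fun n => Real.log n) ∧
      ∃ T : H →L[ℂ] H, T.IsPositive ∧ IsCompactOperator T ∧
        HasEigenvalueSequence T (incrementEigenvalues fun n => Real.log n) ∧
        Module.finrank ℂ (LinearMap.ker (T : H →ₗ[ℂ] H)) = 1 ∧
        IsCommutatorOfCompacts T) := by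
  refine ⟨fun d hd T hT hc hs =>
      isCommutatorOfCompacts_of_hasEigenvalueSequence_incrementEigenvalues hd hT hc hs,
    fun d hd T hT hc hs => ?_, exists_incrementCondition_iff_exists_meanCondition,
    ⟨incrementCondition_sqrt, ?_⟩, ⟨incrementCondition_log_add_one, ?_⟩,
    ⟨incrementCondition_log, ?_⟩⟩
  · rw [directEigenvalues_eq_incrementEigenvalues] at hs
    exact isCommutatorOfCompacts_of_hasEigenvalueSequence_incrementEigenvalues
      (hd.congr fun n => by ring) hT hc hs
  · exact exists_isStrictlyPositiveOperator_incrementEigenvalues hH incrementCondition_sqrt.2.2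
      (by simp) fun n _ => Real.sqrt_lt_sqrt n.cast_nonneg (by simp)
  · exact exists_isStrictlyPositiveOperator_incrementEigenvalues hH
      incrementCondition_log_add_one.2.2 (Real.log_pos (by norm_num))
      fun n _ => Real.log_lt_log (by positivity) (by simp)
  · exact exists_isPositive_incrementEigenvalues_finrank_ker_eq_one hH
      incrementCondition_log.2.2 (by simp)
      fun n hn => Real.log_lt_log (by exact_mod_cast hn) (by simp)

theorem theorem3p1 {H : Type*} [NormedAddCommGroup H] [InnerProductSpace ℂ H] [CompleteSpace H]
    [TopologicalSpace.SeparableSpace H] (hH : ¬ FiniteDimensional ℂ H) :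
    -- the condition on increments
    (∀ d : ℕ → ℝ, IncrementCondition d → ∀ T : H →L[ℂ] H, T.IsPositive → IsCompactOperator T →
      HasEigenvalueSequence T (incrementEigenvalues d) → IsCommutatorOfCompacts T) ∧
    -- the direct condition
    (∀ d : ℕ → ℝ, MeanCondition d → ∀ T : H →L[ℂ] H, T.IsPositive → IsCompactOperator T →
      HasEigenvalueSequence T (directEigenvalues d) → IsCommutatorOfCompacts T) ∧
    -- the two conditions describe the same eigenvalue sequences
    (∀ s : ℕ → ℝ, (∃ d, IncrementCondition d ∧ s = incrementEigenvalues d) ↔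
      ∃ d, MeanCondition d ∧ s = directEigenvalues d) ∧
    -- examples
    (IncrementCondition (fun n => Real.sqrt n) ∧
      ∃ T : H →L[ℂ] H, IsStrictlyPositiveOperator T ∧ IsCompactOperator T ∧
        HasEigenvalueSequence T (incrementEigenvalues fun n => Real.sqrt n) ∧
        IsCommutatorOfCompacts T) ∧
    (IncrementCondition (fun n => Real.log (n + 1)) ∧
      ∃ T : H →L[ℂ] H, IsStrictlyPositiveOperator T ∧ IsCompactOperator T ∧
        HasEigenvalueSequence T (incrementEigenvalues fun n => Real.log (n + 1)) ∧
        IsCommutatorOfCompacts T) ∧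
    (IncrementCondition (fun n => Real.log n) ∧
      ∃ T : H →L[ℂ] H, T.IsPositive ∧ IsCompactOperator T ∧
        HasEigenvalueSequence T (incrementEigenvalues fun n => Real.log n) ∧
        Module.finrank ℂ (LinearMap.ker (T : H →ₗ[ℂ] H)) = 1 ∧
        IsCommutatorOfCompacts T) := by
  obtain ⟨hincrement, hdirect, hrest⟩ := theorem3p1_general hH
  exact ⟨fun d hd T hT => hincrement d hd.2.2 T hT.isSymmetric,
    fun d hd T hT => hdirect d hd.2 T hT.isSymmetric, hrest⟩
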